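/- For a finite simplicial graph $\Gamma$ let $A(\Gamma)=\langle V(\Gamma)\mid [v,w]=1 \text{ for all } \{v,w\}\in E(\Gamma)\rangle$ be the right-angled Artin group on $\Gamma$. Let $F$ be a field, let $V_\Gamma=H^1(A(\Gamma),F)$ and $W_\Gamma=H^2(A(\Gamma),F)$ be the cohomology groups with trivial coefficients, and let $q_\Gamma\colon V_\Gamma\times V_\Gamma\to W_\Gamma$ be the cup product pairing. Then the abstract triple $(V_\Gamma,W_\Gamma,q_\Gamma)$, taken without any chosen bases, determines $\Gamma$ up to isomorphism. That is, if $\Gamma$ and $\Lambda$ are finite simplicial graphs and there are $F$-linear isomorphisms $\varphi\colon V_\Gamma\to V_\Lambda$ and $\psi\colon W_\Gamma\to W_\Lambda$ such that $$\psi(q_\Gamma(a,b))=q_\Lambda(\varphi(a),\varphi(b))\quad\text{for all } a,b\in V_\Gamma,$$ then $\Gamma$ and $\Lambda$ are isomorphic graphs. -/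

import Mathlib

universe u

/-- The right-angled Artin group `A(Γ)` of a simple graph `Γ`: one generator for every vertex, and
one relation `[v, w] = 1` for every edge `{v, w}` of `Γ`. -/
abbrev RightAngledArtinGroup {V : Type u} (Γ : SimpleGraph V) : Type u :=
  PresentedGroup
    {r : FreeGroup V | ∃ v w : V, Γ.Adj v w ∧
      r = FreeGroup.of v * FreeGroup.of w * (FreeGroup.of v)⁻¹ * (FreeGroup.of w)⁻¹}

namespace TrivialCoeff

noncomputable section

open groupCohomology

/-- `H¹(G, R)`, where `G` acts trivially on `R`. -/
abbrev HOne (R G : Type u) [CommRing R] [Group G] : Type u :=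
  H1 (Rep.trivial R G R)

/-- `H²(G, R)`, where `G` acts trivially on `R`. -/
abbrev HTwo (R G : Type u) [CommRing R] [Group G] : Type u :=
  H2 (Rep.trivial R G R)

variable {R G : Type u} [CommRing R] [Group G]

/-- The cup product of two inhomogeneous 1-cocycles with trivial coefficients in `R`:
the 2-cocycle `(x, y) ↦ f x * g y`. -/
def cupCocycle (f g : cocycles₁ (Rep.trivial R G R)) : cocycles₂ (Rep.trivial R G R) :=
  ⟨fun p => ((f p.1 : R) * (g p.2 : R) : R), by
    rw [mem_cocycles₂_iff]
    intro x y z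
    have h1 : (f (x * y) : R) = f x + f y := cocycles₁_map_mul_of_isTrivial f x y
    have h2 : (g (y * z) : R) = g y + g z := cocycles₁_map_mul_of_isTrivial g y z
    change (f (x * y) : R) * (g z : R) + (f x : R) * (g y : R)
      = (f y : R) * (g z : R) + (f x : R) * (g (y * z) : R)
    rw [h1, h2]
    ring⟩

/-- The cup product on cocycles, with values in `H²`, as a bilinear map. -/
def cupAux : cocycles₁ (Rep.trivial R G R) →ₗ[R] cocycles₁ (Rep.trivial R G R) →ₗ[R] HTwo R G :=
  LinearMap.mk₂ R (fun f g => (H2π (Rep.trivial R G R)).hom (cupCocycle f g))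
    (fun f f' g => by
      rw [← map_add]
      congr 1
      ext x y
      exact add_mul (f x : R) (f' x : R) (g y : R))
    (fun c f g => by
      rw [← map_smul]
      congr 1
      ext x y
      exact mul_assoc c (f x : R) (g y : R))
    (fun f g g' => by
      rw [← map_add]
      congr 1
      ext x y
      exact mul_add (f x : R) (g y : R) (g' y : R))
    (fun c f g => by
      rw [← map_smul]
      congr 1
      ext x y
      exact mul_left_comm (f x : R) c (g y : R))

/-- With trivial coefficients there are no nonzero 1-coboundaries, so that the projection from
1-cocycles to `H¹` is an isomorphism. -/
theorem H1π_bijective :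
    Function.Bijective (H1π (Rep.trivial R G R)).hom := by
  constructor
  · rw [injective_iff_map_eq_zero]
    intro f hf
    have h := (H1π_eq_zero_iff f).1 hf
    rw [coboundaries₁_eq_bot_of_isTrivial] at h
    ext x
    exact congrFun ((Submodule.mem_bot R).1 h) x
  · exact (ModuleCat.epi_iff_surjective _).1 inferInstance

/-- The projection from 1-cocycles to `H¹`, as a linear equivalence. -/
def cocyclesEquivHOne : cocycles₁ (Rep.trivial R G R) ≃ₗ[R] HOne R G :=
  LinearEquiv.ofBijective (H1π (Rep.trivial R G R)).hom H1π_bijective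

variable (R G) in
/-- The cup product pairing `H¹(G, R) × H¹(G, R) → H²(G, R)`. -/
def cup : HOne R G →ₗ[R] HOne R G →ₗ[R] HTwo R G :=
  cupAux.compl₁₂ cocyclesEquivHOne.symm.toLinearMap cocyclesEquivHOne.symm.toLinearMap

/-- The cup product of the classes of `f` and `g` is the class of `(x, y) ↦ f x * g y`. -/
theorem cup_H1π (f g : cocycles₁ (Rep.trivial R G R)) :
    cup R G ((H1π (Rep.trivial R G R)).hom f) ((H1π (Rep.trivial R G R)).hom g)
      = (H2π (Rep.trivial R G R)).hom (cupCocycle f g) := by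
  have h (f : cocycles₁ (Rep.trivial R G R)) :
      cocyclesEquivHOne.symm ((H1π (Rep.trivial R G R)).hom f) = f :=
    cocyclesEquivHOne.symm_apply_apply f
  change cupAux (cocyclesEquivHOne.symm _) (cocyclesEquivHOne.symm _) = _
  rw [h, h]
  rfl

end

end TrivialCoeff

/-- Two triples `(V, W, q)` and `(V', W', q')`, each consisting of two vector spaces and a bilinear
map `q : V × V → W`, are isomorphic if there are linear isomorphisms `φ : V ≃ V'` and
`ψ : W ≃ W'` with `ψ (q a b) = q' (φ a) (φ b)` for all `a`, `b`. -/
def PairingIsomorphic {F : Type*} [Field F] {V W V' W' : Type*}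
    [AddCommGroup V] [Module F V] [AddCommGroup W] [Module F W]
    [AddCommGroup V'] [Module F V'] [AddCommGroup W'] [Module F W']
    (q : V →ₗ[F] V →ₗ[F] W) (q' : V' →ₗ[F] V' →ₗ[F] W') : Prop :=
  ∃ (φ : V ≃ₗ[F] V') (ψ : W ≃ₗ[F] W'), ∀ a b : V, ψ (q a b) = q' (φ a) (φ b)

/-! Only the vanishing of cup products is needed. In coordinates on the generators, `a ∪ b = 0`
exactly when `a v * b w = a w * b v` along every edge, so `φ` becomes a linear isomorphism
preserving this relation, in every characteristic.

With `n` vertices, the weights related to a basis vector at `v` form a space of dimension `n - deg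
v`; for a general `a` the dimension is at most `n - deg x` for each `x` in its support. A nonzero
Leibniz term of `det φ` gives a bijection `σ` of vertices with `σ v` in the support of the image of
the basis vector at `v`. Comparing dimensions, for `φ` and its inverse, shows that `σ` preserves
degrees. The equality case of the bound (`adj_of_finrank_edgeCentralizer`) then shows that `σ`
reflects adjacency, and equal degrees make it an isomorphism. -/

/-- The unitriangular Heisenberg group over a commutative ring, in coordinates. -/
@[ext]
structure HeisenbergGroup (R : Type*) where
  fst : R
  snd : R
  ctr : R

namespace HeisenbergGroup

variable {R : Type*} [CommRing R]

/-- The minus sign makes `ctr` a primitive of the cocycle `(x, y) ↦ x.fst * y.snd`. -/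
instance : Mul (HeisenbergGroup R) :=
  ⟨fun x y => ⟨x.fst + y.fst, x.snd + y.snd, x.ctr + y.ctr - x.fst * y.snd⟩⟩

instance : One (HeisenbergGroup R) := ⟨⟨0, 0, 0⟩⟩

instance : Inv (HeisenbergGroup R) := ⟨fun x => ⟨-x.fst, -x.snd, -x.ctr - x.fst * x.snd⟩⟩

@[simp] theorem mul_fst (x y : HeisenbergGroup R) : (x * y).fst = x.fst + y.fst := rfl
@[simp] theorem mul_snd (x y : HeisenbergGroup R) : (x * y).snd = x.snd + y.snd := rfl
@[simp] theorem mul_ctr (x y : HeisenbergGroup R) :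
    (x * y).ctr = x.ctr + y.ctr - x.fst * y.snd := rfl
@[simp] theorem one_fst : (1 : HeisenbergGroup R).fst = 0 := rfl
@[simp] theorem one_snd : (1 : HeisenbergGroup R).snd = 0 := rfl
@[simp] theorem one_ctr : (1 : HeisenbergGroup R).ctr = 0 := rfl
@[simp] theorem inv_fst (x : HeisenbergGroup R) : x⁻¹.fst = -x.fst := rfl
@[simp] theorem inv_snd (x : HeisenbergGroup R) : x⁻¹.snd = -x.snd := rfl
@[simp] theorem inv_ctr (x : HeisenbergGroup R) : x⁻¹.ctr = -x.ctr - x.fst * x.snd := rfl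

instance : Group (HeisenbergGroup R) :=
  Group.ofLeftAxioms
    (fun x y z => by ext <;> simp <;> ring)
    (fun x => by ext <;> simp)
    (fun x => by ext <;> simp [add_assoc, sub_eq_add_neg])

end HeisenbergGroup

namespace RightAngledArtinGroup

variable {α : Type*} {Γ : SimpleGraph α}

/-- The generator of `A(Γ)` belonging to a vertex. -/
def of (Γ : SimpleGraph α) (v : α) : RightAngledArtinGroup Γ := PresentedGroup.of v

theorem of_commute {v w : α} (h : Γ.Adj v w) : of Γ v * of Γ w = of Γ w * of Γ v := by
  have : PresentedGroup.mk {r : FreeGroup α | ∃ v w : α, Γ.Adj v w ∧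
      r = FreeGroup.of v * FreeGroup.of w * (FreeGroup.of v)⁻¹ * (FreeGroup.of w)⁻¹}
      (FreeGroup.of v * FreeGroup.of w * (FreeGroup.of v)⁻¹ * (FreeGroup.of w)⁻¹) = 1 :=
    PresentedGroup.one_of_mem ⟨v, w, h, rfl⟩
  simp only [map_mul, map_inv] at this
  rw [mul_inv_eq_one, mul_inv_eq_iff_eq_mul] at this
  exact this

/-- The homomorphism out of `A(Γ)` given by images of the generators that commute along edges. -/
def lift {G : Type*} [Group G] (f : α → G) (hf : ∀ v w, Γ.Adj v w → f v * f w = f w * f v) :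
    RightAngledArtinGroup Γ →* G :=
  PresentedGroup.toGroup (f := f) (by
    rintro _ ⟨v, w, h, rfl⟩
    simp only [map_mul, map_inv, FreeGroup.lift_apply_of]
    rw [mul_inv_eq_one, mul_inv_eq_iff_eq_mul, hf v w h])

@[simp]
theorem lift_of {G : Type*} [Group G] (f : α → G)
    (hf : ∀ v w, Γ.Adj v w → f v * f w = f w * f v) (v : α) : lift f hf (of Γ v) = f v :=
  PresentedGroup.toGroup.of _

theorem hom_ext {G : Type*} [Group G] {f g : RightAngledArtinGroup Γ →* G}
    (h : ∀ v, f (of Γ v) = g (of Γ v)) : f = g :=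
  PresentedGroup.ext h

end RightAngledArtinGroup

/-- Two vectors of vertex weights commute if they are proportional along every edge. -/
def SimpleGraph.EdgeProportional {α R : Type*} [Mul R] (Γ : SimpleGraph α) (a b : α → R) : Prop :=
  ∀ v w, Γ.Adj v w → a v * b w = a w * b v

/-! ### Vanishing of cup products -/

namespace TrivialCoeff

noncomputable section

open groupCohomology RightAngledArtinGroup

section Cocycles

variable {R G : Type u} [CommRing R] [Group G]

/-- A 1-cocycle with trivial coefficients is a homomorphism. -/
def cocycleHom (f : cocycles₁ (Rep.trivial R G R)) : G →* Multiplicative R where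
  toFun x := Multiplicative.ofAdd (f x : R)
  map_one' := congrArg Multiplicative.ofAdd (cocycles₁_map_one f)
  map_mul' x y := congrArg Multiplicative.ofAdd (cocycles₁_map_mul_of_isTrivial f x y)

/-- A homomorphism to the coefficients is a 1-cocycle. -/
def homCocycle (f : G →* Multiplicative R) : cocycles₁ (Rep.trivial R G R) :=
  ⟨fun x => ((f x).toAdd : R), by
    rw [mem_cocycles₁_iff]
    intro x y
    change (f (x * y)).toAdd = (f y).toAdd + (f x).toAdd
    rw [map_mul, toAdd_mul, add_comm]⟩

/-- The class of the cup product of two cocycles vanishes exactly if it has a primitive. -/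
theorem H2π_cupCocycle_eq_zero_iff (f g : cocycles₁ (Rep.trivial R G R)) :
    (H2π (Rep.trivial R G R)).hom (cupCocycle f g) = 0 ↔
      ∃ h : G → R, ∀ x y, h y - h (x * y) + h x = (f x : R) * (g y : R) := by
  refine (H2π_eq_zero_iff (cupCocycle f g)).trans ?_
  constructor
  · rintro ⟨h, hh⟩
    exact ⟨h, fun x y => congrFun hh (x, y)⟩
  · rintro ⟨h, hh⟩
    exact ⟨h, funext fun p => hh p.1 p.2⟩

end Cocycles

variable {F : Type u} [Field F] {α : Type u} (Γ : SimpleGraph α)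

/-- The 1-cocycles of `A(Γ)` are the families of values on the generators. -/
def cocyclesEquivFun :
    cocycles₁ (Rep.trivial F (RightAngledArtinGroup Γ) F) ≃ₗ[F] (α → F) where
  toFun f v := (f (of Γ v) : F)
  map_add' _ _ := rfl
  map_smul' _ _ := rfl
  invFun a := homCocycle (lift (fun v => Multiplicative.ofAdd (a v)) fun _ _ _ => mul_comm _ _)
  left_inv f := by
    have h : lift (fun v => Multiplicative.ofAdd (f (of Γ v) : F)) (fun _ _ _ => mul_comm _ _)
        = cocycleHom f := hom_ext fun v => lift_of _ _ v
    ext x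
    exact congrArg Multiplicative.toAdd (DFunLike.congr_fun h x)
  right_inv a := by
    funext v
    exact congrArg Multiplicative.toAdd
      (lift_of (Γ := Γ) (fun v => Multiplicative.ofAdd (a v)) (fun _ _ _ => mul_comm _ _) v)

theorem H2π_cupCocycle_eq_zero_iff_edgeProportional
    (f g : cocycles₁ (Rep.trivial F (RightAngledArtinGroup Γ) F)) :
    (H2π (Rep.trivial F (RightAngledArtinGroup Γ) F)).hom (cupCocycle f g) = 0 ↔
      Γ.EdgeProportional (cocyclesEquivFun Γ f) (cocyclesEquivFun Γ g) := by
  rw [H2π_cupCocycle_eq_zero_iff]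
  constructor
  · rintro ⟨h, hh⟩ v w hvw
    change (f (of Γ v) : F) * (g (of Γ w) : F) = (f (of Γ w) : F) * (g (of Γ v) : F)
    -- The coboundary of `h` is symmetric on commuting pairs.
    rw [← hh, ← hh, of_commute hvw]
    ring
  · intro hfg
    -- Edge proportionality is what makes these images commute; the central coordinate of `L` is
    -- then the primitive.
    let L : RightAngledArtinGroup Γ →* HeisenbergGroup F :=
      lift (fun v => ⟨f (of Γ v), g (of Γ v), 0⟩) (by
        intro v w hvw
        have := hfg v w hvw
        change (f (of Γ v) : F) * (g (of Γ w) : F) = (f (of Γ w) : F) * (g (of Γ v) : F) at this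
        ext
        · exact add_comm (f (of Γ v) : F) (f (of Γ w) : F)
        · exact add_comm (g (of Γ v) : F) (g (of Γ w) : F)
        · change (0 + 0 - (f (of Γ v) : F) * (g (of Γ w) : F) : F)
            = 0 + 0 - (f (of Γ w) : F) * (g (of Γ v) : F)
          rw [this])
    have hL (v : α) : L (of Γ v) = ⟨f (of Γ v), g (of Γ v), 0⟩ := lift_of _ _ v
    let p₁ : HeisenbergGroup F →* Multiplicative F :=
      { toFun := fun x => Multiplicative.ofAdd x.fst, map_one' := rfl, map_mul' := fun _ _ => rfl }
    let p₂ : HeisenbergGroup F →* Multiplicative F :=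
      { toFun := fun x => Multiplicative.ofAdd x.snd, map_one' := rfl, map_mul' := fun _ _ => rfl }
    have h₁ : p₁.comp L = cocycleHom f := hom_ext fun v =>
      congrArg (fun x => Multiplicative.ofAdd (HeisenbergGroup.fst x)) (hL v)
    have h₂ : p₂.comp L = cocycleHom g := hom_ext fun v =>
      congrArg (fun x => Multiplicative.ofAdd (HeisenbergGroup.snd x)) (hL v)
    refine ⟨fun x => (L x).ctr, fun x y => ?_⟩
    have e₁ : (L x).fst = (f x : F) := congrArg Multiplicative.toAdd (DFunLike.congr_fun h₁ x)
    have e₂ : (L y).snd = (g y : F) := congrArg Multiplicative.toAdd (DFunLike.congr_fun h₂ y)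
    beta_reduce
    rw [map_mul, HeisenbergGroup.mul_ctr, e₁, e₂]
    ring

variable (F) in
/-- The coordinates on `H¹(A(Γ), F)` given by the values on the generators. -/
def hOneEquivFun : HOne F (RightAngledArtinGroup Γ) ≃ₗ[F] (α → F) :=
  cocyclesEquivHOne.symm.trans (cocyclesEquivFun Γ)

theorem cup_eq_zero_iff (a b : HOne F (RightAngledArtinGroup Γ)) :
    cup F (RightAngledArtinGroup Γ) a b = 0 ↔
      Γ.EdgeProportional (hOneEquivFun F Γ a) (hOneEquivFun F Γ b) :=
  H2π_cupCocycle_eq_zero_iff_edgeProportional Γ (cocyclesEquivHOne.symm a)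
    (cocyclesEquivHOne.symm b)

end

end TrivialCoeff

/-- A linear isomorphism between spaces of functions on finite types has a nonvanishing term in the
Leibniz expansion of its determinant. -/
theorem LinearEquiv.exists_equiv_apply_single_ne_zero {F α β : Type*} [Field F] [Finite α]
    [Finite β] [DecidableEq α] (φ : (α → F) ≃ₗ[F] (β → F)) :
    ∃ σ : α ≃ β, ∀ v, φ (Pi.single v 1) (σ v) ≠ 0 := by
  classical
  have := Fintype.ofFinite α
  have := Fintype.ofFinite β
  have hc : Fintype.card α = Fintype.card β := by
    simpa using φ.finrank_eq
  let e : α ≃ β := Fintype.equivOfCardEq hc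
  let ψ : (α → F) ≃ₗ[F] (α → F) := φ.trans (LinearEquiv.funCongrLeft F F e)
  have hdet : (LinearMap.toMatrix' ψ.toLinearMap).det ≠ 0 := by
    rw [LinearMap.det_toMatrix']
    exact ψ.isUnit_det'.ne_zero
  rw [Matrix.det_apply] at hdet
  obtain ⟨τ, -, hτ⟩ := Finset.exists_ne_zero_of_sum_ne_zero hdet
  refine ⟨τ.trans e, fun v hv => hτ ?_⟩
  rw [Finset.prod_eq_zero (Finset.mem_univ v), smul_zero]
  rw [LinearMap.toMatrix'_apply]
  exact hv

/-! ### Dimensions of centralizers -/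

namespace SimpleGraph

section

variable {F α : Type*} [Field F] (Γ : SimpleGraph α)

/-- The weights that are proportional to `a` along every edge. -/
def edgeCentralizer (a : α → F) : Submodule F (α → F) where
  carrier := {b | Γ.EdgeProportional a b}
  zero_mem' v w _ := by simp
  add_mem' hb hc v w h := by
    simp only [Pi.add_apply, mul_add, hb v w h, hc v w h]
  smul_mem' c b hb v w h := by
    simp only [Pi.smul_apply, smul_eq_mul, mul_left_comm _ c, hb v w h]

variable {Γ}

theorem mem_edgeCentralizer {a b : α → F} :
    b ∈ Γ.edgeCentralizer a ↔ Γ.EdgeProportional a b := Iff.rfl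

theorem EdgeProportional.eq_zero_of_adj {a b : α → F} (h : Γ.EdgeProportional a b) {x t : α}
    (hx : a x ≠ 0) (hb : b x = 0) (hxt : Γ.Adj x t) : b t = 0 := by
  have := h x t hxt
  rw [hb, mul_zero] at this
  exact (mul_eq_zero.1 this).resolve_left hx

variable [Fintype α]

/-- Restriction to the complement of `T` is injective on the centralizer. -/
theorem finrank_edgeCentralizer_add_card_le (a : α → F) (T : Finset α)
    (hT : ∀ b, Γ.EdgeProportional a b → (∀ x ∉ T, b x = 0) → ∀ x ∈ T, b x = 0) :
    Module.finrank F (Γ.edgeCentralizer a) + T.card ≤ Fintype.card α := by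
  classical
  let r : Γ.edgeCentralizer a →ₗ[F] ({x // x ∉ T} → F) :=
    (LinearMap.funLeft F F Subtype.val).comp (Γ.edgeCentralizer a).subtype
  have hr : Function.Injective r := by
    rw [injective_iff_map_eq_zero]
    intro b hb
    have h0 : ∀ x ∉ T, (b : α → F) x = 0 := fun x hx => congrFun hb ⟨x, hx⟩
    ext x
    by_cases hx : x ∈ T
    · exact hT b b.2 h0 x hx
    · exact h0 x hx
  have h := LinearMap.finrank_le_finrank_of_injective hr
  rw [Module.finrank_fintype_fun_eq_card, Fintype.card_subtype_compl, Fintype.card_coe] at h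
  have := Finset.card_le_univ T
  omega

variable [DecidableRel Γ.Adj]

theorem finrank_edgeCentralizer_add_degree_le {a : α → F} {x : α} (hx : a x ≠ 0) :
    Module.finrank F (Γ.edgeCentralizer a) + Γ.degree x ≤ Fintype.card α :=
  finrank_edgeCentralizer_add_card_le a (Γ.neighborFinset x) fun b hb h0 t ht =>
    hb.eq_zero_of_adj hx (h0 x (by simp)) (by simpa using ht)

/-- The bound is attained because every weight vanishing on the neighbors of `v` lies in the
centralizer. -/
theorem finrank_edgeCentralizer_single [DecidableEq α] (v : α) :
    Module.finrank F (Γ.edgeCentralizer (Pi.single v (1 : F))) + Γ.degree v = Fintype.card α := by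
  refine le_antisymm (finrank_edgeCentralizer_add_degree_le (by simp)) ?_
  let r : (α → F) →ₗ[F] (Γ.neighborFinset v → F) := LinearMap.funLeft F F Subtype.val
  have hk : LinearMap.ker r ≤ Γ.edgeCentralizer (Pi.single v (1 : F)) := by
    intro b hb x y hxy
    have h0 (t : α) (ht : Γ.Adj v t) : b t = 0 :=
      congrFun hb ⟨t, by simpa using ht⟩
    by_cases hx : x = v
    · subst hx
      simp [h0 y hxy, hxy.ne']
    · by_cases hy : y = v
      · subst hy
        simp [h0 x hxy.symm, hx]
      · simp [hx, hy]
  have h1 := Submodule.finrank_mono hk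
  have h2 := r.finrank_range_add_finrank_ker
  have h3 := (LinearMap.range r).finrank_le
  rw [Module.finrank_fintype_fun_eq_card, Fintype.card_coe, card_neighborFinset_eq_degree] at h3
  rw [Module.finrank_fintype_fun_eq_card] at h2
  omega

/-- If the centralizer of `a` has the largest dimension that `x` in the support of `a` allows, then
vertices of the same degree in the support are twins of `x`; if `x` has an adjacent twin in the
support, then they are all adjacent to `x`. -/
theorem adj_of_finrank_edgeCentralizer {a : α → F} {x y z : α} (hx : a x ≠ 0) (hy : a y ≠ 0)
    (hz : a z ≠ 0) (hxy : Γ.Adj x y) (hzx : z ≠ x) (hd : Γ.degree z = Γ.degree x)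
    (ha : Module.finrank F (Γ.edgeCentralizer a) + Γ.degree x = Fintype.card α) :
    Γ.Adj x z := by
  classical
  -- As the dimension is the largest possible, the values on the neighbors of `x` and one further
  -- vertex `t` cannot all be forced by the others.
  have key (t : α) (ht : ¬ Γ.Adj x t)
      (h : ∀ b, Γ.EdgeProportional a b → (∀ s, ¬ Γ.Adj x s → s ≠ t → b s = 0) →
        b x = 0 ∧ b t = 0) : False := by
    have := finrank_edgeCentralizer_add_card_le (Γ := Γ) a (insert t (Γ.neighborFinset x))
      fun b hb h0 s hs => by
        have h' := h b hb fun s hs hst => h0 s (by simp [hs, hst])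
        rcases Finset.mem_insert.1 hs with rfl | hs
        · exact h'.2
        · exact hb.eq_zero_of_adj hx h'.1 (by simpa using hs)
    rw [Finset.card_insert_of_notMem (by simpa using ht), card_neighborFinset_eq_degree] at this
    omega
  by_contra hxz
  have hyx (t : α) (hyt : Γ.Adj y t) (htx : t ≠ x) : Γ.Adj x t := by
    by_contra ht
    refine key t ht fun b hb h0 => ?_
    have hbx : b x = 0 := h0 x (by simp) htx.symm
    exact ⟨hbx, hb.eq_zero_of_adj hy (hb.eq_zero_of_adj hx hbx hxy) hyt⟩
  have hsub : Γ.neighborFinset z ⊆ Γ.neighborFinset x := by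
    intro t ht
    rw [mem_neighborFinset] at ht ⊢
    by_contra hxt
    refine key t hxt fun b hb h0 => ?_
    have htx : x ≠ t := by
      rintro rfl
      exact hxz ht.symm
    exact ⟨h0 x (by simp) htx, hb.eq_zero_of_adj hz (h0 z hxz ht.ne) ht⟩
  have heq := Finset.eq_of_subset_of_card_le hsub (by simp [hd])
  have hzy : Γ.Adj z y := by
    rw [← mem_neighborFinset, heq, mem_neighborFinset]
    exact hxy
  exact hxz (hyx z hzy.symm hzx)

end

/-! ### Transport along the linear isomorphism -/

theorem finrank_edgeCentralizer_map {F α β : Type*} [Field F] {Γ : SimpleGraph α} {Λ : SimpleGraph β}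
    {φ : (α → F) ≃ₗ[F] (β → F)}
    (hφ : ∀ a b, Γ.EdgeProportional a b ↔ Λ.EdgeProportional (φ a) (φ b)) (a : α → F) :
    Module.finrank F (Λ.edgeCentralizer (φ a)) = Module.finrank F (Γ.edgeCentralizer a) := by
  have : (Γ.edgeCentralizer a).map φ.toLinearMap = Λ.edgeCentralizer (φ a) := by
    ext b
    constructor
    · rintro ⟨c, hc, rfl⟩
      exact (hφ a c).1 hc
    · intro hb
      refine ⟨φ.symm b, (hφ a _).2 ?_, by simp⟩
      simpa using mem_edgeCentralizer.1 hb
  rw [← this]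
  exact LinearEquiv.finrank_map_eq φ _

theorem edgeProportional_symm_iff {F α β : Type*} [Field F] {Γ : SimpleGraph α} {Λ : SimpleGraph β}
    {φ : (α → F) ≃ₗ[F] (β → F)}
    (hφ : ∀ a b, Γ.EdgeProportional a b ↔ Λ.EdgeProportional (φ a) (φ b)) (a b : β → F) :
    Λ.EdgeProportional a b ↔ Γ.EdgeProportional (φ.symm a) (φ.symm b) := by
  rw [hφ, φ.apply_symm_apply, φ.apply_symm_apply]

theorem finrank_edgeCentralizer_map_single {F α β : Type*} [Field F] [Fintype α] [Fintype β]
    [DecidableEq α] {Γ : SimpleGraph α} {Λ : SimpleGraph β} [DecidableRel Γ.Adj]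
    {φ : (α → F) ≃ₗ[F] (β → F)}
    (hφ : ∀ a b, Γ.EdgeProportional a b ↔ Λ.EdgeProportional (φ a) (φ b)) (v : α) :
    Module.finrank F (Λ.edgeCentralizer (φ (Pi.single v 1))) + Γ.degree v = Fintype.card β := by
  have hc : Fintype.card α = Fintype.card β := by simpa using φ.finrank_eq
  rw [finrank_edgeCentralizer_map hφ, finrank_edgeCentralizer_single, hc]

section

variable {F α β : Type*} [Field F] [Fintype α] [Fintype β] [DecidableEq α]
  {Γ : SimpleGraph α} {Λ : SimpleGraph β} [DecidableRel Γ.Adj] [DecidableRel Λ.Adj]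
  {φ : (α → F) ≃ₗ[F] (β → F)}

theorem degree_le_of_map_single_ne_zero
    (hφ : ∀ a b, Γ.EdgeProportional a b ↔ Λ.EdgeProportional (φ a) (φ b)) {v : α} {x : β}
    (h : φ (Pi.single v 1) x ≠ 0) : Λ.degree x ≤ Γ.degree v := by
  have h1 := finrank_edgeCentralizer_map_single hφ v
  have h2 := finrank_edgeCentralizer_add_degree_le (Γ := Λ) h
  omega

theorem sum_degree_le (hφ : ∀ a b, Γ.EdgeProportional a b ↔ Λ.EdgeProportional (φ a) (φ b)) :
    ∑ x, Λ.degree x ≤ ∑ v, Γ.degree v := by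
  obtain ⟨σ, hσ⟩ := φ.exists_equiv_apply_single_ne_zero
  rw [← σ.sum_comp]
  exact Finset.sum_le_sum fun v _ => degree_le_of_map_single_ne_zero hφ (hσ v)

/-- The inequality holds termwise, and the degree sums agree by applying `sum_degree_le` to
`φ.symm`. -/
theorem degree_eq_of_map_single_ne_zero
    (hφ : ∀ a b, Γ.EdgeProportional a b ↔ Λ.EdgeProportional (φ a) (φ b)) {σ : α ≃ β}
    (hσ : ∀ v, φ (Pi.single v 1) (σ v) ≠ 0) (v : α) : Λ.degree (σ v) = Γ.degree v := by
  classical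
  have h1 : ∀ v ∈ Finset.univ, Λ.degree (σ v) ≤ Γ.degree v := fun v _ =>
    degree_le_of_map_single_ne_zero hφ (hσ v)
  have h2 : ∑ v, Λ.degree (σ v) = ∑ v, Γ.degree v := by
    refine le_antisymm (Finset.sum_le_sum h1) ?_
    rw [σ.sum_comp fun x => Λ.degree x]
    exact sum_degree_le (edgeProportional_symm_iff hφ)
  exact (Finset.sum_eq_sum_iff_of_le h1).1 h2 v (Finset.mem_univ v)

end

/-- A vector with a vertex of degree `k` in its support has one of degree at least `k` in the
support of its image. -/
theorem exists_degree_le_of_apply_ne_zero {F α β : Type*} [Field F] [Fintype α] [Fintype β]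
    {Γ : SimpleGraph α} {Λ : SimpleGraph β} [DecidableRel Γ.Adj] [DecidableRel Λ.Adj]
    {φ : (α → F) ≃ₗ[F] (β → F)}
    (hφ : ∀ a b, Γ.EdgeProportional a b ↔ Λ.EdgeProportional (φ a) (φ b)) {a : α → F} {v : α}
    (hv : a v ≠ 0) : ∃ z, φ a z ≠ 0 ∧ Γ.degree v ≤ Λ.degree z := by
  classical
  by_contra! h
  apply hv
  have h1 : a = ∑ z, φ a z • φ.symm (Pi.single z 1) := by
    rw [← φ.symm_apply_apply a]
    conv_lhs => rw [pi_eq_sum_univ' (φ a), map_sum]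
    simp only [map_smul, φ.apply_symm_apply]
  rw [h1, Finset.sum_apply]
  refine Finset.sum_eq_zero fun z _ => ?_
  rw [Pi.smul_apply, smul_eq_mul, mul_eq_zero]
  by_contra! hz
  exact (h z hz.1).not_ge
    (degree_le_of_map_single_ne_zero (edgeProportional_symm_iff hφ) hz.2)

section

variable {F α β : Type*} [Field F] [Fintype α] [Fintype β] [DecidableEq α]
  {Γ : SimpleGraph α} {Λ : SimpleGraph β} [DecidableRel Γ.Adj] [DecidableRel Λ.Adj]
  {φ : (α → F) ≃ₗ[F] (β → F)}

/-- If `v` and `w` were not adjacent, their basis vectors would be related, so both images would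
have `σ v` and `σ w` in their supports, with all degrees equal. A combination of the images
vanishing at `σ v` and its neighbors still has a vertex of that degree in its support, against the
equality case. -/
theorem adj_of_adj_map
    (hφ : ∀ a b, Γ.EdgeProportional a b ↔ Λ.EdgeProportional (φ a) (φ b)) {σ : α ≃ β}
    (hσ : ∀ v, φ (Pi.single v 1) (σ v) ≠ 0) {v w : α} (h : Λ.Adj (σ v) (σ w)) : Γ.Adj v w := by
  by_contra hvw
  have hne : v ≠ w := by
    rintro rfl
    exact h.ne rfl
  have hab : Λ.EdgeProportional (φ (Pi.single v 1)) (φ (Pi.single w 1)) := by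
    rw [← hφ]
    intro s t hst
    by_cases hs : s = v
    · subst hs
      have : t ≠ w := by
        rintro rfl
        exact hvw hst
      simp [hst.ne', this]
    · by_cases ht : t = v
      · subst ht
        have : s ≠ w := by
          rintro rfl
          exact hvw hst.symm
        simp [hs, this]
      · simp [hs, ht]
  have hdv := degree_eq_of_map_single_ne_zero hφ hσ v
  have hdw := degree_eq_of_map_single_ne_zero hφ hσ w
  have hKa := finrank_edgeCentralizer_map_single hφ v
  have hKb := finrank_edgeCentralizer_map_single hφ w
  have hax := hσ v
  have hby := hσ w
  have hmul := mul_ne_zero hax hby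
  rw [hab _ _ h] at hmul
  have hay := left_ne_zero_of_mul hmul
  have hbx := right_ne_zero_of_mul hmul
  have hle := degree_le_of_map_single_ne_zero hφ hay
  have hge := degree_le_of_map_single_ne_zero hφ hbx
  -- Chosen to cancel the value at `σ v`; proportionality then cancels it at the neighbors too.
  set c : F := φ (Pi.single v 1) (σ v) / φ (Pi.single w 1) (σ v) with hc
  obtain ⟨z, hz, hdz⟩ := exists_degree_le_of_apply_ne_zero hφ
    (a := Pi.single v (1 : F) - c • Pi.single w (1 : F)) (v := v) (by simp [hne])
  rw [map_sub, map_smul, Pi.sub_apply, Pi.smul_apply, smul_eq_mul] at hz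
  have hzx : z ≠ σ v := by
    rintro rfl
    apply hz
    rw [hc, div_mul_cancel₀ _ hbx, sub_self]
  have hnadj : ¬ Λ.Adj (σ v) z := by
    intro hadj
    apply hz
    have := hab _ _ hadj
    rw [hc]
    field_simp
    rw [this]
    ring
  by_cases haz : φ (Pi.single v 1) z = 0
  · have hbz : φ (Pi.single w 1) z ≠ 0 := by
      intro hbz
      apply hz
      rw [haz, hbz, mul_zero, sub_zero]
    have := degree_le_of_map_single_ne_zero hφ hbz
    exact hnadj (adj_of_finrank_edgeCentralizer hbx hby hbz h hzx (by omega) (by omega))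
  · have := degree_le_of_map_single_ne_zero hφ haz
    exact hnadj (adj_of_finrank_edgeCentralizer hax hay haz h hzx (by omega) (by omega))

end

/-- A finite graph is determined by the relation of edgewise proportionality on its weights. -/
theorem nonempty_iso_of_edgeProportional_iff {F α β : Type*} [Field F] [Finite α] [Finite β]
    {Γ : SimpleGraph α} {Λ : SimpleGraph β} (φ : (α → F) ≃ₗ[F] (β → F))
    (hφ : ∀ a b, Γ.EdgeProportional a b ↔ Λ.EdgeProportional (φ a) (φ b)) :
    Nonempty (Γ ≃g Λ) := by
  classical
  have := Fintype.ofFinite α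
  have := Fintype.ofFinite β
  obtain ⟨σ, hσ⟩ := φ.exists_equiv_apply_single_ne_zero
  refine ⟨⟨σ, fun {v w} => ⟨adj_of_adj_map hφ hσ, fun hvw => ?_⟩⟩⟩
  -- Reflected adjacency embeds one neighborhood in the other; equal degrees make this an equality.
  have hsub : (Λ.neighborFinset (σ v)).map σ.symm.toEmbedding ⊆ Γ.neighborFinset v := by
    intro t ht
    obtain ⟨y, hy, rfl⟩ := Finset.mem_map.1 ht
    rw [mem_neighborFinset] at hy ⊢
    exact adj_of_adj_map hφ hσ (by simpa using hy)
  have heq := Finset.eq_of_subset_of_card_le hsub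
    (by simp [degree_eq_of_map_single_ne_zero hφ hσ v])
  have hw : w ∈ Γ.neighborFinset v := by simpa using hvw
  rw [← heq] at hw
  obtain ⟨y, hy, rfl⟩ := Finset.mem_map.1 hw
  simpa using hy

end SimpleGraph

theorem theorem2 {F : Type u} [Field F] {α β : Type u} [Finite α] [Finite β]
    (Γ : SimpleGraph α) (Λ : SimpleGraph β)
    (h : PairingIsomorphic (TrivialCoeff.cup F (RightAngledArtinGroup Γ))
      (TrivialCoeff.cup F (RightAngledArtinGroup Λ))) :
    Nonempty (Γ ≃g Λ) := by
  obtain ⟨φ, ψ, hq⟩ := h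
  refine SimpleGraph.nonempty_iso_of_edgeProportional_iff
    ((TrivialCoeff.hOneEquivFun F Γ).symm.trans (φ.trans (TrivialCoeff.hOneEquivFun F Λ)))
    fun a b => ?_
  have h1 := TrivialCoeff.cup_eq_zero_iff Γ ((TrivialCoeff.hOneEquivFun F Γ).symm a)
    ((TrivialCoeff.hOneEquivFun F Γ).symm b)
  rw [LinearEquiv.apply_symm_apply, LinearEquiv.apply_symm_apply] at h1
  rw [← h1, ← ψ.map_eq_zero_iff, hq]
  exact TrivialCoeff.cup_eq_zero_iff Λ _ _
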